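/- For $\lambda\in(0,1)$ and $x>0$ let $$g_\lambda(x)=\frac{x^\lambda\,\Gamma(x)}{\Gamma(\lambda+x)}.$$ For $\tau\in\mathbb R$ let $\mathcal S_\tau$ (the generalized Stieltjes class of order $\tau$) be the set of functions $f:(0,\infty)\to\mathbb R$ of the form $$f(x)=\int_{[0,\infty)}\frac{d\mu(t)}{(t+x)^{\tau}}+c\qquad(x>0),$$ where $\mu$ is a positive Borel measure on $[0,\infty)$ for which the integral converges for every $x>0$, and $c\ge 0$ is a constant. Then, for every $\lambda\in(0,1)$, the function $\log g_\lambda$ belongs to $\mathcal S_2$, and it does not belong to $\mathcal S_\tau$ for any real $\tau<2$. -/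

import Mathlib

open MeasureTheory Set

/-- `g_lam(x) = x ^ lam * Γ(x) / Γ(lam + x)`, meant for `x > 0`. -/
noncomputable def gLambda (lam x : ℝ) : ℝ :=
  x ^ lam * Real.Gamma x / Real.Gamma (lam + x)

/-- The generalized Stieltjes class of order `τ`, as a property of the restriction of `f` to
`(0, ∞)`: there are a positive Borel measure `μ` on `[0, ∞)` and a constant `c ≥ 0` such that, for
all `x > 0`, the integral of `1 / (t + x) ^ τ` converges and `f x = ∫ dμ(t) / (t + x) ^ τ + c`. -/
def IsGeneralizedStieltjes (τ : ℝ) (f : ℝ → ℝ) : Prop :=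
  ∃ (μ : Measure ℝ) (c : ℝ), 0 ≤ c ∧ ∀ x : ℝ, 0 < x →
    IntegrableOn (fun t : ℝ => 1 / (t + x) ^ τ) (Ici 0) μ ∧
      f x = (∫ t in Ici (0 : ℝ), 1 / (t + x) ^ τ ∂μ) + c

open Filter Topology ENNReal


/-! Euler's limit for Γ writes log g as the sum over n of the Jensen gaps log(n+x+lam) - (1-lam)
log(n+x) - lam log(n+x+1). Since -log'' has the shape 1/(t+x)^2, each gap is the integral of
1/(t+x)^2 against a tent on [n, n+1] with peak at n + lam. So log g is the order-two transform of
the density `tentWave lam`, with c = 0 (`lintegral_tentMeasure_sq`).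

Suppose log g also had order τ < 2. It is positive and tends to 0 along the integers, which excludes
τ ≤ 0 and forces c = 0. For 0 < τ < 2, put a = 1 - τ: integrating w^a / (w+y)^2 over w > 0 gives C
y^(-τ) with 0 < C < ∞. Hence C log g is the order-two transform of the convolution of μ with w₊^a.
The order-two measure is unique (`ext_of_lintegral_one_div_add_sq`), so this convolution equals C
times the tent wave almost everywhere. But the tent wave tends to 0 at 1 from the left, whereas mass
of μ on [0, 1/2] keeps the convolution away from 0 there. So that mass vanishes, and the convolution
is 0 on (0, 1/2), where the tent wave is positive (`not_tentWave_ae_eq_truncPowConv`). -/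

/-! ### The order-two representation of log g -/

/-- The `1`-periodic function `t ↦ min ((1 - lam) * {t}) (lam * (1 - {t}))`. -/
noncomputable def tentWave (lam t : ℝ) : ℝ :=
  min ((1 - lam) * Int.fract t) (lam * (1 - Int.fract t))

/-- The measure on `[0, ∞)` with density `tentWave lam`. -/
noncomputable def tentMeasure (lam : ℝ) : Measure ℝ :=
  (volume.restrict (Ici 0)).withDensity fun t => ENNReal.ofReal (tentWave lam t)

lemma measurable_tentWave (lam : ℝ) : Measurable (tentWave lam) := by
  unfold tentWave; fun_prop

lemma tentWave_nonneg {lam : ℝ} (h0 : 0 < lam) (h1 : lam < 1) (t : ℝ) : 0 ≤ tentWave lam t := by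
  have := Int.fract_nonneg t
  have := (Int.fract_lt_one t).le
  exact le_min (mul_nonneg (by linarith) (by linarith)) (mul_nonneg h0.le (by linarith))

lemma tentWave_of_mem_Ico {lam t : ℝ} {n : ℕ} (ht : t ∈ Ico (n : ℝ) (n + 1)) :
    tentWave lam t = min ((1 - lam) * (t - n)) (lam * (n + 1 - t)) := by
  have : ⌊t⌋ = n := by rw [Int.floor_eq_iff]; exact_mod_cast ht
  rw [tentWave, Int.fract, this]; push_cast; ring_nf

lemma tentWave_pos {lam t : ℝ} (h0 : 0 < lam) (h1 : lam < 1) (ht : t ∈ Ioo (0 : ℝ) 1) :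
    0 < tentWave lam t := by
  rw [tentWave, Int.fract_eq_self.2 ⟨ht.1.le, ht.2⟩]
  exact lt_min (mul_pos (by linarith) ht.1) (mul_pos h0 (by linarith [ht.2]))

lemma tentWave_le {lam t : ℝ} (h1 : lam < 1) (ht : t ∈ Ioo (0 : ℝ) 1) :
    tentWave lam t ≤ 1 - t := by
  rw [tentWave, Int.fract_eq_self.2 ⟨ht.1.le, ht.2⟩]
  refine (min_le_right _ _).trans ?_
  nlinarith [ht.2]

/-- The tent is the Green's function of -d²/dt² on [a, a+1] with pole a + lam, and the right side is
the Jensen gap of log there. -/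
lemma integral_tent_div_sq {lam x a : ℝ} (h0 : 0 < lam) (h1 : lam < 1) (hx : 0 < a + x) :
    ∫ t in a..a + 1, min ((1 - lam) * (t - a)) (lam * (a + 1 - t)) / (t + x) ^ 2 =
      Real.log (a + x + lam) - (1 - lam) * Real.log (a + x) - lam * Real.log (a + x + 1) := by
  have hcont : ∀ b c : ℝ, a ≤ b → a ≤ c → IntervalIntegrable
      (fun t => min ((1 - lam) * (t - a)) (lam * (a + 1 - t)) / (t + x) ^ 2) volume b c := by
    intro b c hb hc
    refine ContinuousOn.intervalIntegrable (ContinuousOn.div (by fun_prop) (by fun_prop) ?_)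
    intro t ht
    have : a ≤ t := (le_min hb hc).trans ht.1
    have : 0 < t + x := by linarith
    positivity
  -- The two branches of the minimum cross at a + lam; each has an elementary primitive.
  rw [← intervalIntegral.integral_add_adjacent_intervals
    (hcont a (a + lam) le_rfl (by linarith)) (hcont (a + lam) (a + 1) (by linarith) (by linarith))]
  have e1 : ∫ t in a..a + lam, min ((1 - lam) * (t - a)) (lam * (a + 1 - t)) / (t + x) ^ 2 =
      (1 - lam) * (Real.log (a + lam + x) + (a + x) / (a + lam + x)) -
        (1 - lam) * (Real.log (a + x) + (a + x) / (a + x)) := by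
    refine intervalIntegral.integral_eq_sub_of_hasDerivAt
      (f := fun t => (1 - lam) * (Real.log (t + x) + (a + x) / (t + x))) ?_
      (hcont _ _ le_rfl (by linarith))
    intro t ht
    rw [uIcc_of_le (by linarith)] at ht
    have hp : t + x ≠ 0 := by linarith [ht.1]
    have hd : HasDerivAt (fun t : ℝ => t + x) 1 t := (hasDerivAt_id t).add_const x
    have := ((hd.log hp).add ((hasDerivAt_const t (a + x)).div hd hp)).const_mul (1 - lam)
    refine this.congr_deriv ?_
    rw [min_eq_left (by nlinarith [ht.2])]
    field_simp
    ring
  have e2 : ∫ t in a + lam..a + 1, min ((1 - lam) * (t - a)) (lam * (a + 1 - t)) / (t + x) ^ 2 =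
      lam * (-((a + x + 1) / (a + 1 + x)) - Real.log (a + 1 + x)) -
        lam * (-((a + x + 1) / (a + lam + x)) - Real.log (a + lam + x)) := by
    refine intervalIntegral.integral_eq_sub_of_hasDerivAt
      (f := fun t => lam * (-((a + x + 1) / (t + x)) - Real.log (t + x))) ?_
      (hcont _ _ (by linarith) (by linarith))
    intro t ht
    rw [uIcc_of_le (by linarith)] at ht
    have hp : t + x ≠ 0 := by linarith [ht.1]
    have hd : HasDerivAt (fun t : ℝ => t + x) 1 t := (hasDerivAt_id t).add_const x
    have := (((hasDerivAt_const t (a + x + 1)).div hd hp).neg.sub (hd.log hp)).const_mul lam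
    refine this.congr_deriv ?_
    rw [min_eq_right (by nlinarith [ht.1])]
    field_simp
    ring
  rw [e1, e2, show a + lam + x = a + x + lam by ring, show a + 1 + x = a + x + 1 by ring]
  have p1 : a + x + lam ≠ 0 := by linarith
  have p2 : a + x + 1 ≠ 0 := by linarith
  have p3 : a + x ≠ 0 := by linarith
  field_simp
  ring

lemma lintegral_Ico_tentWave {lam x : ℝ} (h0 : 0 < lam) (h1 : lam < 1) (hx : 0 < x) (n : ℕ) :
    0 ≤ Real.log (n + x + lam) - (1 - lam) * Real.log (n + x) - lam * Real.log (n + x + 1) ∧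
    ∫⁻ t in Ico (n : ℝ) (n + 1), ENNReal.ofReal (tentWave lam t) * ENNReal.ofReal (1 / (t + x) ^ 2) =
      ENNReal.ofReal (Real.log (n + x + lam) - (1 - lam) * Real.log (n + x)
        - lam * Real.log (n + x + 1)) := by
  have hnx : 0 < (n : ℝ) + x := by positivity
  have hn : (n : ℝ) ≤ n + 1 := by linarith
  rw [← integral_tent_div_sq h0 h1 hnx, intervalIntegral.integral_of_le hn,
    ← Measure.restrict_congr_set (μ := volume) (Ico_ae_eq_Ioc (a := (n : ℝ)) (b := (n : ℝ) + 1))]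
  have hnn : ∀ t ∈ Ico (n : ℝ) (n + 1),
      0 ≤ min ((1 - lam) * (t - n)) (lam * (n + 1 - t)) / (t + x) ^ 2 := by
    intro t ht
    have := tentWave_nonneg h0 h1 t
    rw [tentWave_of_mem_Ico ht] at this
    positivity
  refine ⟨setIntegral_nonneg measurableSet_Ico hnn, ?_⟩
  rw [ofReal_integral_eq_lintegral_ofReal]
  · refine setLIntegral_congr_fun measurableSet_Ico fun t ht => ?_
    rw [tentWave_of_mem_Ico ht, ← ENNReal.ofReal_mul, mul_one_div]
    rw [← tentWave_of_mem_Ico ht]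
    exact tentWave_nonneg h0 h1 t
  · refine (ContinuousOn.integrableOn_Icc (ContinuousOn.div (by fun_prop) (by fun_prop) ?_)).mono_set
      Ico_subset_Icc_self
    intro t ht
    have : 0 < t + x := by linarith [ht.1]
    positivity
  · exact (ae_restrict_iff' measurableSet_Ico).2 (ae_of_all _ hnn)

/-- In the difference of the limits for log Γ at x and lam + x the factorials cancel; the rest of
the partial sum telescopes up to lam (log(N+1+x) - log N), which tends to 0. -/
lemma hasSum_log_gLambda {lam x : ℝ} (h0 : 0 < lam) (h1 : lam < 1) (hx : 0 < x) :
    HasSum (fun n : ℕ => Real.log (n + x + lam) - (1 - lam) * Real.log (n + x)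
        - lam * Real.log (n + x + 1)) (Real.log (gLambda lam x)) := by
  rw [hasSum_iff_tendsto_nat_of_nonneg (fun n => (lintegral_Ico_tentWave h0 h1 hx n).1),
    -- `logGammaSeq` at N sums N + 1 logarithms, so the partial sums are shifted by one.
    ← tendsto_add_atTop_iff_nat 1]
  have hΓ := Real.Gamma_pos_of_pos hx
  have hΓ' := Real.Gamma_pos_of_pos (add_pos h0 hx)
  have hg : Real.log (gLambda lam x) = lam * Real.log x +
      (Real.log (Real.Gamma x) - Real.log (Real.Gamma (lam + x))) - lam * 0 := by
    rw [gLambda, Real.log_div (by positivity) hΓ'.ne', Real.log_mul (by positivity) hΓ.ne',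
      Real.log_rpow hx]
    ring
  have hlog : Tendsto (fun N : ℕ => Real.log (N + 1 + x) - Real.log N) atTop (𝓝 0) := by
    have h := Real.tendsto_log_comp_add_sub_log (1 + x)
    refine (h.comp tendsto_natCast_atTop_atTop).congr fun N => ?_
    simp [add_assoc]
  rw [hg]
  refine ((((Real.BohrMollerup.tendsto_log_gamma hx).sub
    (Real.BohrMollerup.tendsto_log_gamma (add_pos h0 hx))).const_add _).sub
      (hlog.const_mul lam)).congr fun N => ?_
  have htel : ∀ M : ℕ, ∑ n ∈ Finset.range M, (Real.log (n + x + lam) - (1 - lam) * Real.log (n + x)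
        - lam * Real.log (n + x + 1)) = ∑ m ∈ Finset.range M, Real.log (lam + x + m)
        - ∑ m ∈ Finset.range M, Real.log (x + m) - lam * (Real.log (M + x) - Real.log x) := by
    intro M
    induction M with
    | zero => simp
    | succ M ih =>
      rw [Finset.sum_range_succ, Finset.sum_range_succ, Finset.sum_range_succ, ih]
      push_cast
      rw [show lam + x + M = M + x + lam by ring, show x + M = M + x by ring,
        show (M : ℝ) + 1 + x = M + x + 1 by ring]
      ring
  rw [htel, Real.BohrMollerup.logGammaSeq, Real.BohrMollerup.logGammaSeq]
  push_cast
  ring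

lemma lintegral_tentMeasure (lam : ℝ) {k : ℝ → ℝ≥0∞} (hk : Measurable k) :
    ∫⁻ t, k t ∂tentMeasure lam = ∫⁻ t in Ici 0, ENNReal.ofReal (tentWave lam t) * k t := by
  rw [tentMeasure, lintegral_withDensity_eq_lintegral_mul _
    (measurable_tentWave lam).ennreal_ofReal hk]
  rfl

/-- `log g_lam` is the Stieltjes transform of order `2` of `tentMeasure lam`. -/
lemma lintegral_tentMeasure_sq {lam x : ℝ} (h0 : 0 < lam) (h1 : lam < 1) (hx : 0 < x) :
    ∫⁻ t, ENNReal.ofReal (1 / (t + x) ^ 2) ∂tentMeasure lam =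
      ENNReal.ofReal (Real.log (gLambda lam x)) := by
  have hU : Ici (0 : ℝ) = ⋃ n : ℕ, Ico (n : ℝ) (n + 1) := by
    ext t
    simp only [mem_Ici, mem_iUnion, mem_Ico]
    exact ⟨fun ht => ⟨⌊t⌋₊, Nat.floor_le ht, Nat.lt_floor_add_one t⟩,
      fun ⟨n, hn, _⟩ => (Nat.cast_nonneg n).trans hn⟩
  have hD : Pairwise (Function.onFun Disjoint fun n : ℕ => Ico (n : ℝ) (n + 1)) := by
    intro i j hij
    refine Set.disjoint_left.2 fun t hi hj => hij ?_
    have a : (i : ℝ) < j + 1 := hi.1.trans_lt hj.2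
    have b : (j : ℝ) < i + 1 := hj.1.trans_lt hi.2
    norm_cast at a b
    omega
  rw [lintegral_tentMeasure _ (by fun_prop), hU,
    lintegral_iUnion (fun n => measurableSet_Ico) hD,
    ← (hasSum_log_gLambda h0 h1 hx).tsum_eq,
    ENNReal.ofReal_tsum_of_nonneg (fun n => (lintegral_Ico_tentWave h0 h1 hx n).1)
      (hasSum_log_gLambda h0 h1 hx).summable]
  exact tsum_congr fun n => (lintegral_Ico_tentWave h0 h1 hx n).2

lemma log_gLambda_nonneg {lam x : ℝ} (h0 : 0 < lam) (h1 : lam < 1) (hx : 0 < x) :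
    0 ≤ Real.log (gLambda lam x) :=
  (hasSum_log_gLambda h0 h1 hx).nonneg fun n => (lintegral_Ico_tentWave h0 h1 hx n).1

lemma tentMeasure_Iio (lam : ℝ) : tentMeasure lam (Iio 0) = 0 := by
  refine withDensity_absolutelyContinuous _ _ ?_
  rw [Measure.restrict_apply measurableSet_Iio]
  convert measure_empty (μ := volume)
  ext t; simp

lemma restrict_Ici_of_Iio_null {μ : Measure ℝ} (h : μ (Iio 0) = 0) : μ.restrict (Ici 0) = μ := by
  refine Measure.restrict_eq_self_of_ae_mem ?_
  rw [ae_iff]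
  simpa [Iio] using h

lemma isGeneralizedStieltjes_two_log_gLambda {lam : ℝ} (h0 : 0 < lam) (h1 : lam < 1) :
    IsGeneralizedStieltjes 2 (fun x : ℝ => Real.log (gLambda lam x)) := by
  refine ⟨tentMeasure lam, 0, le_rfl, fun x hx => ?_⟩
  rw [IntegrableOn, restrict_Ici_of_Iio_null (tentMeasure_Iio lam)]
  simp_rw [Real.rpow_two]
  have hnn : ∀ t : ℝ, 0 ≤ 1 / (t + x) ^ 2 := fun t => by positivity
  have hm : Measurable fun t : ℝ => 1 / (t + x) ^ 2 := by fun_prop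
  refine ⟨⟨hm.aestronglyMeasurable, ?_⟩, ?_⟩
  · rw [hasFiniteIntegral_iff_ofReal (ae_of_all _ hnn), lintegral_tentMeasure_sq h0 h1 hx]
    exact ofReal_lt_top
  · rw [integral_eq_lintegral_of_nonneg_ae (ae_of_all _ hnn) hm.aestronglyMeasurable,
      lintegral_tentMeasure_sq h0 h1 hx, ENNReal.toReal_ofReal (log_gLambda_nonneg h0 h1 hx),
      add_zero]

/-! ### Positivity and decay of log g -/

lemma log_gLambda_pos {lam x : ℝ} (h0 : 0 < lam) (h1 : lam < 1) (hx : 0 < x) :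
    0 < Real.log (gLambda lam x) := by
  rw [← ENNReal.ofReal_pos, ← lintegral_tentMeasure_sq h0 h1 hx,
    lintegral_tentMeasure _ (by fun_prop)]
  refine lt_of_lt_of_le ?_ (lintegral_mono_set (Ioo_subset_Icc_self.trans Icc_subset_Ici_self :
    Ioo (0 : ℝ) 1 ⊆ Ici 0))
  have hmeas : Measurable fun t =>
      ENNReal.ofReal (tentWave lam t) * ENNReal.ofReal (1 / (t + x) ^ 2) :=
    (measurable_tentWave lam).ennreal_ofReal.mul (by fun_prop)
  rw [setLIntegral_pos_iff hmeas]
  have : Ioo (0 : ℝ) 1 ⊆ Function.support (fun t =>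
      ENNReal.ofReal (tentWave lam t) * ENNReal.ofReal (1 / (t + x) ^ 2)) := by
    intro t ht
    have := tentWave_pos h0 h1 ht
    have : 0 < t + x := by linarith [ht.1]
    exact mul_ne_zero (by simpa) (by simp; positivity)
  rw [inter_eq_right.2 this]
  simp

lemma tendsto_log_gLambda {lam : ℝ} (h0 : 0 < lam) (h1 : lam < 1) :
    Tendsto (fun n : ℕ => Real.log (gLambda lam (n + 1))) atTop (𝓝 0) := by
  have hpos : ∀ n : ℕ, (0 : ℝ) < n + 1 := fun n => by positivity
  have key : Tendsto (fun n : ℕ => ∫⁻ t, ENNReal.ofReal (1 / (t + ((n : ℝ) + 1)) ^ 2)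
      ∂tentMeasure lam) atTop (𝓝 (∫⁻ _, 0 ∂tentMeasure lam)) := by
    -- The kernel at x = 1 dominates, and its integral is the finite number log g(1).
    refine tendsto_lintegral_of_dominated_convergence
      (fun t => ENNReal.ofReal (1 / (t + 1) ^ 2)) (fun n => by fun_prop) (fun n => ?_) ?_ ?_
    · rw [← restrict_Ici_of_Iio_null (tentMeasure_Iio lam)]
      refine (ae_restrict_iff' measurableSet_Ici).2 (ae_of_all _ fun t ht => ?_)
      have ht' : (0 : ℝ) ≤ t := ht
      refine ENNReal.ofReal_le_ofReal (one_div_le_one_div_of_le (by positivity) ?_)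
      gcongr
      linarith [hpos n, (Nat.cast_nonneg n : (0 : ℝ) ≤ n)]
    · rw [lintegral_tentMeasure_sq h0 h1 one_pos]
      exact ofReal_ne_top
    · refine ae_of_all _ fun t => ?_
      rw [← ENNReal.ofReal_zero]
      refine ENNReal.tendsto_ofReal ?_
      have : Tendsto (fun n : ℕ => (t + ((n : ℝ) + 1)) ^ 2) atTop atTop :=
        (tendsto_pow_atTop two_ne_zero).comp
          (tendsto_atTop_add_const_left _ _
            (tendsto_atTop_add_const_right _ _ tendsto_natCast_atTop_atTop))
      simpa [Pi.inv_def] using this.inv_tendsto_atTop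
  rw [lintegral_zero] at key
  have := (ENNReal.tendsto_toReal zero_ne_top).comp key
  refine this.congr fun n => ?_
  rw [Function.comp_apply, lintegral_tentMeasure_sq h0 h1 (hpos n),
    ENNReal.toReal_ofReal (log_gLambda_nonneg h0 h1 (hpos n))]

/-! ### Uniqueness of the order-two measure -/

lemma hasDerivAt_integral_one_div_add_pow {ν : Measure ℝ} (hν : ∀ᵐ t ∂ν, 0 ≤ t) {n : ℕ}
    (hint : ∀ x : ℝ, 0 < x → Integrable (fun t => 1 / (t + x) ^ (n + 1)) ν) {x : ℝ} (hx : 0 < x) :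
    Integrable (fun t => 1 / (t + x) ^ (n + 2)) ν ∧
      HasDerivAt (fun y => ∫ t, 1 / (t + y) ^ (n + 1) ∂ν)
        (-(n + 1) * ∫ t, 1 / (t + x) ^ (n + 2) ∂ν) x := by
  have hn : (-((n : ℝ) + 1)) ≠ 0 := by
    have : (0 : ℝ) < n + 1 := by positivity
    linarith
  have key := hasDerivAt_integral_of_dominated_loc_of_deriv_le (μ := ν) (x₀ := x)
    (s := Ioi (x / 2)) (F := fun y t => 1 / (t + y) ^ (n + 1))
    (F' := fun y t => -((n : ℝ) + 1) * (1 / (t + y) ^ (n + 2)))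
    -- For y > x/2 and t ≥ 0, one factor 1/(t+y) is at most 2/x; the remaining n + 1 factors are
    -- integrable at x/2.
    (bound := fun t => ((n : ℝ) + 1) * (2 / x) * (1 / (t + x / 2) ^ (n + 1)))
    (Ioi_mem_nhds (by linarith)) (Eventually.of_forall fun y => by
      have : Measurable fun t : ℝ => 1 / (t + y) ^ (n + 1) := by fun_prop
      exact this.aestronglyMeasurable)
    (hint x hx)
    (by
      have : Measurable fun t : ℝ => -((n : ℝ) + 1) * (1 / (t + x) ^ (n + 2)) := by fun_prop
      exact this.aestronglyMeasurable)
    (hν.mono fun t ht y hy => ?_) ((hint (x / 2) (by linarith)).const_mul _)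
    (hν.mono fun t ht y hy => ?_)
  · rw [integral_const_mul] at key
    refine ⟨?_, key.2⟩
    exact (integrable_const_mul_iff (isUnit_iff_ne_zero.2 hn) _).1 key.1
  · have hy' : x / 2 < y := hy
    have h1 : 0 < t + x / 2 := by linarith
    have h2 : 0 < t + y := by linarith
    rw [Real.norm_eq_abs, abs_mul, abs_neg, abs_of_pos (by positivity : (0 : ℝ) < n + 1),
      abs_of_pos (by positivity), mul_assoc]
    refine mul_le_mul_of_nonneg_left ?_ (by positivity)
    calc 1 / (t + y) ^ (n + 2) ≤ 1 / (t + x / 2) ^ (n + 2) := by gcongr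
      _ = 1 / (t + x / 2) * (1 / (t + x / 2) ^ (n + 1)) := by
        rw [one_div_mul_one_div, ← pow_succ']
      _ ≤ 2 / x * (1 / (t + x / 2) ^ (n + 1)) := by
        refine mul_le_mul_of_nonneg_right ?_ (by positivity)
        rw [div_le_div_iff₀ h1 hx]
        linarith
  · have hy' : x / 2 < y := hy
    have h1 : t + y ≠ 0 := by linarith
    have hd : HasDerivAt (fun y : ℝ => t + y) 1 y := (hasDerivAt_id y).const_add t
    have := (hd.fun_pow (n + 1)).fun_inv (pow_ne_zero _ h1)
    simp_rw [one_div]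
    refine this.congr_deriv ?_
    rw [add_tsub_cancel_right]
    push_cast
    field_simp
    ring

/-- Equality on the open half-line passes to derivatives in x, and each derivative raises the
exponent by one. -/
lemma integral_one_div_add_pow_eq {ν₁ ν₂ : Measure ℝ} (h₁ : ∀ᵐ t ∂ν₁, 0 ≤ t)
    (h₂ : ∀ᵐ t ∂ν₂, 0 ≤ t)
    (hi₁ : ∀ x : ℝ, 0 < x → Integrable (fun t => 1 / (t + x) ^ 2) ν₁)
    (hi₂ : ∀ x : ℝ, 0 < x → Integrable (fun t => 1 / (t + x) ^ 2) ν₂)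
    (heq : ∀ x : ℝ, 0 < x → ∫ t, 1 / (t + x) ^ 2 ∂ν₁ = ∫ t, 1 / (t + x) ^ 2 ∂ν₂) (n : ℕ) :
    ∀ x : ℝ, 0 < x → Integrable (fun t => 1 / (t + x) ^ (n + 2)) ν₁ ∧
      Integrable (fun t => 1 / (t + x) ^ (n + 2)) ν₂ ∧
      ∫ t, 1 / (t + x) ^ (n + 2) ∂ν₁ = ∫ t, 1 / (t + x) ^ (n + 2) ∂ν₂ := by
  induction n with
  | zero => exact fun x hx => ⟨hi₁ x hx, hi₂ x hx, heq x hx⟩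
  | succ n ih =>
    intro x hx
    obtain ⟨a₁, b₁⟩ := hasDerivAt_integral_one_div_add_pow h₁ (fun x hx => (ih x hx).1) hx
    obtain ⟨a₂, b₂⟩ := hasDerivAt_integral_one_div_add_pow h₂ (fun x hx => (ih x hx).2.1) hx
    refine ⟨a₁, a₂, ?_⟩
    have hev : (fun y => ∫ t, 1 / (t + y) ^ (n + 1 + 1) ∂ν₁) =ᶠ[𝓝 x]
        fun y => ∫ t, 1 / (t + y) ^ (n + 1 + 1) ∂ν₂ := by
      filter_upwards [Ioi_mem_nhds hx] with y hy using (ih y hy).2.2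
    have := b₁.unique (b₂.congr_of_eventuallyEq hev)
    refine mul_left_cancel₀ ?_ this
    have : (0 : ℝ) < (n + 1 : ℕ) + 1 := by positivity
    linarith

open scoped BoundedContinuousFunction NNReal

/-- The bounded continuous function `t ↦ 1 / (t + 1)` on `[0, ∞)`. -/
noncomputable def invAddOne : ℝ≥0 →ᵇ ℝ :=
  BoundedContinuousFunction.ofNormedAddCommGroup (fun t : ℝ≥0 => 1 / ((t : ℝ) + 1))
    (Continuous.div (by fun_prop) (by fun_prop) fun t => by positivity) 1 fun t => by
      rw [Real.norm_eq_abs, abs_of_pos (by positivity), div_le_one (by positivity)]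
      linarith [t.coe_nonneg]

lemma invAddOne_apply (t : ℝ≥0) : invAddOne t = 1 / ((t : ℝ) + 1) := rfl

/-- Finite measures on `[0, ∞)` are determined by the moments of `1 / (t + 1)`. -/
lemma ext_of_integral_invAddOne_pow {P Q : Measure ℝ≥0} [IsFiniteMeasure P] [IsFiniteMeasure Q]
    (h : ∀ n : ℕ, ∫ t, (invAddOne t) ^ n ∂P = ∫ t, (invAddOne t) ^ n ∂Q) : P = Q := by
  -- The polynomials in 1/(t+1): this single injective function already separates points.
  let A : StarSubalgebra ℝ (ℝ≥0 →ᵇ ℝ) :=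
    { Algebra.adjoin ℝ {invAddOne} with
      star_mem' := fun {a} ha => by
        have : star a = a := by ext; simp
        rwa [this] }
  have hu : invAddOne ∈ A := Algebra.subset_adjoin (mem_singleton _)
  have key : ∀ p : Polynomial ℝ, ∫ t, (Polynomial.aeval invAddOne p) t ∂P =
      ∫ t, (Polynomial.aeval invAddOne p) t ∂Q := by
    intro p
    induction p using Polynomial.induction_on' with
    | add p q hp hq =>
      simp only [map_add, BoundedContinuousFunction.coe_add, Pi.add_apply]
      rw [integral_add (BoundedContinuousFunction.integrable _ _)
        (BoundedContinuousFunction.integrable _ _), integral_add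
        (BoundedContinuousFunction.integrable _ _) (BoundedContinuousFunction.integrable _ _),
        hp, hq]
    | monomial n a =>
      simp only [Polynomial.aeval_monomial, BoundedContinuousFunction.coe_mul, Pi.mul_apply,
        BoundedContinuousFunction.coe_pow, Pi.pow_apply]
      simp only [BoundedContinuousFunction.algebraMap_apply, smul_eq_mul, mul_one]
      rw [integral_const_mul, integral_const_mul, h]
  refine ext_of_forall_mem_subalgebra_integral_eq_of_polish (𝕜 := ℝ) (A := A) ?_ ?_
  · intro s t hst
    refine ⟨invAddOne, ⟨_, ⟨invAddOne, hu, rfl⟩, rfl⟩, ?_⟩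
    rw [invAddOne_apply, invAddOne_apply]
    intro he
    rw [one_div, one_div, inv_inj] at he
    exact hst (NNReal.coe_inj.1 (by linarith))
  · intro g hg
    have hg' : g ∈ Algebra.adjoin ℝ {invAddOne} := hg
    rw [Algebra.adjoin_singleton_eq_range_aeval] at hg'
    obtain ⟨p, rfl⟩ := hg'
    exact key p

/-- The weight is finite and almost everywhere positive, so it can be divided out. -/
lemma withDensity_one_div_add_one_sq_injective {ν₁ ν₂ : Measure ℝ} (h₁ : ∀ᵐ t ∂ν₁, 0 ≤ t)
    (h₂ : ∀ᵐ t ∂ν₂, 0 ≤ t)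
    (h : ν₁.withDensity (fun t => ENNReal.ofReal (1 / (t + 1) ^ 2)) =
      ν₂.withDensity fun t => ENNReal.ofReal (1 / (t + 1) ^ 2)) : ν₁ = ν₂ := by
  have hm : Measurable fun t : ℝ => ENNReal.ofReal (1 / (t + 1) ^ 2) := by fun_prop
  have aux : ∀ {ν : Measure ℝ}, (∀ᵐ t ∂ν, 0 ≤ t) →
      (ν.withDensity fun t => ENNReal.ofReal (1 / (t + 1) ^ 2)).withDensity
        (fun t => ENNReal.ofReal (1 / (t + 1) ^ 2))⁻¹ = ν := fun hν =>
    withDensity_inv_same hm (hν.mono fun t ht => by simp; positivity)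
      (ae_of_all _ fun t => ofReal_ne_top)
  rw [← aux h₁, h, aux h₂]

/-- Uniqueness of the measure in a generalized Stieltjes representation of order two. -/
lemma ext_of_lintegral_one_div_add_sq {ν₁ ν₂ : Measure ℝ} (h₁ : ∀ᵐ t ∂ν₁, 0 ≤ t)
    (h₂ : ∀ᵐ t ∂ν₂, 0 ≤ t)
    (hfin : ∀ x : ℝ, 0 < x → ∫⁻ t, ENNReal.ofReal (1 / (t + x) ^ 2) ∂ν₁ ≠ ⊤)
    (heq : ∀ x : ℝ, 0 < x → ∫⁻ t, ENNReal.ofReal (1 / (t + x) ^ 2) ∂ν₁ =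
      ∫⁻ t, ENNReal.ofReal (1 / (t + x) ^ 2) ∂ν₂) : ν₁ = ν₂ := by
  have hnn : ∀ x t : ℝ, 0 ≤ 1 / (t + x) ^ 2 := fun x t => by positivity
  have hm : ∀ x : ℝ, Measurable fun t : ℝ => 1 / (t + x) ^ 2 := fun x => by fun_prop
  have hi₁ : ∀ x : ℝ, 0 < x → Integrable (fun t => 1 / (t + x) ^ 2) ν₁ := fun x hx =>
    ⟨(hm x).aestronglyMeasurable,
      (hasFiniteIntegral_iff_ofReal (ae_of_all _ (hnn x))).2 (hfin x hx).lt_top⟩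
  have hi₂ : ∀ x : ℝ, 0 < x → Integrable (fun t => 1 / (t + x) ^ 2) ν₂ := fun x hx =>
    ⟨(hm x).aestronglyMeasurable,
      (hasFiniteIntegral_iff_ofReal (ae_of_all _ (hnn x))).2 (heq x hx ▸ (hfin x hx).lt_top)⟩
  have hmom := integral_one_div_add_pow_eq h₁ h₂ hi₁ hi₂ (fun x hx => by
    rw [integral_eq_lintegral_of_nonneg_ae (ae_of_all _ (hnn x)) (hm x).aestronglyMeasurable,
      integral_eq_lintegral_of_nonneg_ae (ae_of_all _ (hnn x)) (hm x).aestronglyMeasurable,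
      heq x hx])
  refine withDensity_one_div_add_one_sq_injective h₁ h₂ ?_
  set d : ℝ → ℝ≥0∞ := fun t => ENNReal.ofReal (1 / (t + 1) ^ 2) with hd
  have hdm : Measurable d := by fun_prop
  have : IsFiniteMeasure (ν₁.withDensity d) := isFiniteMeasure_withDensity (hfin 1 one_pos)
  have : IsFiniteMeasure (ν₂.withDensity d) :=
    isFiniteMeasure_withDensity (heq 1 one_pos ▸ hfin 1 one_pos)
  -- The weighted measures live on [0, ∞), so passing to `ℝ≥0` and back loses nothing.
  have hback : ∀ {ν : Measure ℝ}, (∀ᵐ t ∂ν, 0 ≤ t) →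
      ((ν.withDensity d).map Real.toNNReal).map ((↑) : ℝ≥0 → ℝ) = ν.withDensity d := by
    intro ν hν
    rw [Measure.map_map measurable_coe_nnreal_real measurable_real_toNNReal]
    have : ((↑) : ℝ≥0 → ℝ) ∘ Real.toNNReal =ᵐ[ν.withDensity d] id :=
      Eventually.mono ((withDensity_absolutelyContinuous ν d).ae_le hν) fun t ht => by
        simpa using ht
    rw [Measure.map_congr this, Measure.map_id]
  have hint : ∀ {ν : Measure ℝ}, (∀ᵐ t ∂ν, 0 ≤ t) → ∀ n : ℕ,
      ∫ t, (invAddOne t) ^ n ∂(ν.withDensity d).map Real.toNNReal =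
        ∫ t, 1 / (t + 1) ^ (n + 2) ∂ν := by
    intro ν hν n
    rw [integral_map measurable_real_toNNReal.aemeasurable (by fun_prop),
      integral_withDensity_eq_integral_toReal_smul hdm (ae_of_all _ fun t => ofReal_lt_top)]
    refine integral_congr_ae (hν.mono fun t ht => ?_)
    simp only [hd, invAddOne_apply, Real.coe_toNNReal t ht, smul_eq_mul,
      ENNReal.toReal_ofReal (hnn 1 t)]
    rw [← one_div_pow, ← one_div_pow, ← pow_add, add_comm 2 n]
  rw [← hback h₁, ← hback h₂]
  congr 1
  refine ext_of_integral_invAddOne_pow fun n => ?_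
  rw [hint h₁, hint h₂, (hmom n 1 one_pos).2.2]

/-! ### Raising the order to two by convolution -/

/-- The truncated power `w ↦ w₊ ^ a`. -/
noncomputable def truncPow (a w : ℝ) : ℝ≥0∞ := (Ioi 0).indicator (fun w => ENNReal.ofReal (w ^ a)) w

/-- The integral of `w ^ a / (w + 1) ^ 2` over `(0, ∞)`. -/
noncomputable def truncPowConst (a : ℝ) : ℝ≥0∞ :=
  ∫⁻ w, truncPow a w * ENNReal.ofReal (1 / (w + 1) ^ 2)

/-- The convolution of `μ` with the truncated power of exponent `a`. -/
noncomputable def truncPowConv (a : ℝ) (μ : Measure ℝ) (s : ℝ) : ℝ≥0∞ :=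
  ∫⁻ t, truncPow a (s - t) ∂μ

lemma measurable_truncPow (a : ℝ) : Measurable (truncPow a) :=
  Measurable.indicator (by fun_prop) measurableSet_Ioi

lemma truncPow_of_pos {a w : ℝ} (hw : 0 < w) : truncPow a w = ENNReal.ofReal (w ^ a) :=
  indicator_of_mem (mem_Ioi.2 hw) _

lemma truncPow_of_nonpos {a w : ℝ} (hw : w ≤ 0) : truncPow a w = 0 :=
  indicator_of_notMem (by simpa using hw) _

lemma truncPowConst_ne_zero (a : ℝ) : truncPowConst a ≠ 0 := by
  have hmeas : Measurable fun w => truncPow a w * ENNReal.ofReal (1 / (w + 1) ^ 2) :=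
    (measurable_truncPow a).mul (by fun_prop)
  rw [truncPowConst, ← pos_iff_ne_zero]
  refine lt_of_lt_of_le ?_ (setLIntegral_le_lintegral (Ioo (0 : ℝ) 1) _)
  rw [setLIntegral_pos_iff hmeas]
  have : Ioo (0 : ℝ) 1 ⊆ Function.support (fun w =>
      truncPow a w * ENNReal.ofReal (1 / (w + 1) ^ 2)) := by
    intro w hw
    have h0 : 0 < w := hw.1
    rw [Function.mem_support, truncPow_of_pos h0]
    exact mul_ne_zero (by simp; positivity) (by simp; positivity)
  rw [inter_eq_right.2 this]
  simp

/-- Convergence at 0 needs a > -1; at infinity the integrand is at most w^(a-2), which needs a < 1.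
-/
lemma truncPowConst_ne_top {a : ℝ} (ha : -1 < a) (ha' : a < 1) : truncPowConst a ≠ ⊤ := by
  have hU : (univ : Set ℝ) = Iic 0 ∪ (Ioc 0 1 ∪ Ioi 1) := by
    rw [Ioc_union_Ioi_eq_Ioi zero_le_one, Iic_union_Ioi]
  have e0 : ∫⁻ w in Iic (0 : ℝ), truncPow a w * ENNReal.ofReal (1 / (w + 1) ^ 2) = 0 :=
    setLIntegral_eq_zero measurableSet_Iic fun w hw => by simp [truncPow_of_nonpos hw]
  have e1 : ∫⁻ w in Ioc (0 : ℝ) 1, truncPow a w * ENNReal.ofReal (1 / (w + 1) ^ 2) < ⊤ := by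
    have hint : IntegrableOn (fun w : ℝ => w ^ a) (Ioc 0 1) :=
      (intervalIntegrable_iff_integrableOn_Ioc_of_le zero_le_one).1
        (intervalIntegral.intervalIntegrable_rpow' ha)
    refine lt_of_le_of_lt (setLIntegral_mono (by fun_prop) fun w hw => ?_) hint.lintegral_lt_top
    have h0 : 0 < w := hw.1
    rw [truncPow_of_pos h0, ← ENNReal.ofReal_mul (by positivity)]
    refine ENNReal.ofReal_le_ofReal (mul_le_of_le_one_right (by positivity) ?_)
    rw [div_le_one (by positivity)]
    nlinarith
  have e2 : ∫⁻ w in Ioi (1 : ℝ), truncPow a w * ENNReal.ofReal (1 / (w + 1) ^ 2) < ⊤ := by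
    have hint : IntegrableOn (fun w : ℝ => w ^ (a - 2)) (Ioi 1) :=
      integrableOn_Ioi_rpow_of_lt (by linarith) one_pos
    refine lt_of_le_of_lt (setLIntegral_mono (by fun_prop) fun w hw => ?_) hint.lintegral_lt_top
    have h0 : 0 < w := one_pos.trans hw
    rw [truncPow_of_pos h0, ← ENNReal.ofReal_mul (by positivity)]
    refine ENNReal.ofReal_le_ofReal ?_
    rw [Real.rpow_sub h0, Real.rpow_two, div_eq_mul_one_div (w ^ a)]
    refine mul_le_mul_of_nonneg_left
      (one_div_le_one_div_of_le (pow_pos h0 2) ?_) (Real.rpow_nonneg h0.le a)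
    exact pow_le_pow_left₀ h0.le (by linarith) 2
  rw [truncPowConst, ← setLIntegral_univ, hU]
  refine ((lintegral_union_le _ _ _).trans (add_le_add le_rfl (lintegral_union_le _ _ _))).trans_lt
    ?_ |>.ne
  rw [e0, zero_add]
  exact ENNReal.add_lt_top.2 ⟨e1, e2⟩

/-- Substitute w ↦ y w: the integral is homogeneous of degree a - 1 in y. -/
lemma lintegral_truncPow_mul {a y : ℝ} (hy : 0 < y) :
    ∫⁻ w, truncPow a w * ENNReal.ofReal (1 / (w + y) ^ 2) =
      truncPowConst a * ENNReal.ofReal (1 / y ^ (1 - a)) := by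
  have hmeas : Measurable fun w => truncPow a w * ENNReal.ofReal (1 / (w + y) ^ 2) :=
    (measurable_truncPow a).mul (by fun_prop)
  have hmeas1 : Measurable fun w => truncPow a w * ENNReal.ofReal (1 / (w + 1) ^ 2) :=
    (measurable_truncPow a).mul (by fun_prop)
  have h1 := lintegral_map (μ := volume) hmeas (measurable_const_mul y)
  rw [Real.map_volume_mul_left hy.ne', lintegral_smul_measure, abs_of_pos (inv_pos.2 hy)] at h1
  have h2 : ∀ w, truncPow a (y * w) * ENNReal.ofReal (1 / (y * w + y) ^ 2) =
      ENNReal.ofReal (y ^ a / y ^ 2) * (truncPow a w * ENNReal.ofReal (1 / (w + 1) ^ 2)) := by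
    intro w
    rcases le_or_gt w 0 with hw | hw
    · rw [truncPow_of_nonpos hw, truncPow_of_nonpos (mul_nonpos_of_nonneg_of_nonpos hy.le hw)]
      simp
    · rw [truncPow_of_pos hw, truncPow_of_pos (mul_pos hy hw), ← ENNReal.ofReal_mul (by positivity),
        ← ENNReal.ofReal_mul (by positivity), ← ENNReal.ofReal_mul (by positivity),
        Real.mul_rpow hy.le hw.le]
      congr 1
      field_simp
  simp_rw [h2] at h1
  rw [lintegral_const_mul _ hmeas1, ← truncPowConst, smul_eq_mul] at h1
  have h3 : ENNReal.ofReal y * ENNReal.ofReal y⁻¹ = 1 := by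
    rw [← ENNReal.ofReal_mul hy.le, mul_inv_cancel₀ hy.ne', ENNReal.ofReal_one]
  rw [← one_mul (∫⁻ w, _), ← h3, mul_assoc, h1, ← mul_assoc, ← ENNReal.ofReal_mul hy.le, mul_comm]
  congr 2
  rw [Real.rpow_sub hy, Real.rpow_one]
  field_simp

lemma measurable_truncPowConv (a : ℝ) (μ : Measure ℝ) [SFinite μ] :
    Measurable (truncPowConv a μ) :=
  Measurable.lintegral_prod_right' (f := fun p : ℝ × ℝ => truncPow a (p.1 - p.2))
    ((measurable_truncPow a).comp (by fun_prop))

lemma truncPowConv_of_neg {a s : ℝ} {μ : Measure ℝ} (hμ : ∀ᵐ t ∂μ, 0 ≤ t) (hs : s < 0) :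
    truncPowConv a μ s = 0 := by
  rw [truncPowConv, ← lintegral_zero (μ := μ)]
  exact lintegral_congr_ae (hμ.mono fun t ht => truncPow_of_nonpos (by linarith))

/-- A Stieltjes transform of order `1 - a` is, up to a constant, one of order two. -/
lemma lintegral_truncPowConv_mul {a x : ℝ} {μ : Measure ℝ} [SFinite μ] (hμ : ∀ᵐ t ∂μ, 0 ≤ t)
    (hx : 0 < x) :
    ∫⁻ s in Ici 0, truncPowConv a μ s * ENNReal.ofReal (1 / (s + x) ^ 2) =
      truncPowConst a * ∫⁻ t, ENNReal.ofReal (1 / (t + x) ^ (1 - a)) ∂μ := by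
  have hm : Measurable fun p : ℝ × ℝ => truncPow a (p.1 - p.2) *
      ENNReal.ofReal (1 / (p.1 + x) ^ 2) :=
    ((measurable_truncPow a).comp (by fun_prop)).mul (by fun_prop)
  have hfull : ∫⁻ s in Ici 0, truncPowConv a μ s * ENNReal.ofReal (1 / (s + x) ^ 2) =
      ∫⁻ s, truncPowConv a μ s * ENNReal.ofReal (1 / (s + x) ^ 2) := by
    rw [← lintegral_indicator measurableSet_Ici]
    congr 1
    refine indicator_eq_self.2 fun s hs => ?_
    by_contra hneg
    exact hs (by simp [truncPowConv_of_neg hμ (not_le.1 hneg)])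
  rw [hfull]
  have h1 : ∀ s, truncPowConv a μ s * ENNReal.ofReal (1 / (s + x) ^ 2) =
      ∫⁻ t, truncPow a (s - t) * ENNReal.ofReal (1 / (s + x) ^ 2) ∂μ := fun s =>
    (lintegral_mul_const _ ((measurable_truncPow a).comp (by fun_prop))).symm
  simp_rw [h1]
  rw [lintegral_lintegral_swap hm.aemeasurable, ← lintegral_const_mul _ (by fun_prop)]
  refine lintegral_congr_ae (hμ.mono fun t ht => ?_)
  -- After Tonelli, the shift w = s - t turns s + x into w + (t + x).
  have h2 := lintegral_sub_right_eq_self (μ := volume)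
    (fun w => truncPow a w * ENNReal.ofReal (1 / (w + (t + x)) ^ 2)) t
  rw [lintegral_truncPow_mul (by linarith)] at h2
  refine Eq.trans ?_ h2
  refine lintegral_congr fun s => ?_
  rw [show s - t + (t + x) = s + x by ring]

/-! ### The convolution is not a tent wave -/

lemma exists_mem_Ioo_of_ae_restrict_Ici {p : ℝ → Prop} (h : ∀ᵐ s ∂volume.restrict (Ici 0), p s)
    {b c : ℝ} (hb : 0 ≤ b) (hbc : b < c) : ∃ s ∈ Ioo b c, p s := by
  by_contra! hne
  rw [ae_restrict_iff' measurableSet_Ici, ae_iff] at h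
  have : Ioo b c ⊆ {s | ¬ (s ∈ Ici 0 → p s)} := fun s hs hp => hne s hs (hp (hb.trans hs.1.le))
  have := measure_mono_null this h
  simp only [Real.volume_Ioo, ENNReal.ofReal_eq_zero] at this
  linarith

/-- For t in [0, 1/2], s - t lies in [1/4, 1]; the minimum covers both signs of a. -/
lemma le_truncPowConv {a s : ℝ} {μ : Measure ℝ} (hμ : ∀ᵐ t ∂μ, 0 ≤ t) (hs : s ∈ Ioo (3 / 4 : ℝ) 1) :
    ENNReal.ofReal (min ((1 / 4) ^ a) 1) * μ (Iic (1 / 2)) ≤ truncPowConv a μ s := by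
  rw [← setLIntegral_const]
  refine (setLIntegral_mono_ae ((measurable_truncPow a).comp
    (by fun_prop : Measurable fun t => s - t)).aemeasurable ?_).trans
    (setLIntegral_le_lintegral _ _)
  refine hμ.mono fun t ht ht' => ?_
  have ht' : t ≤ 1 / 2 := ht'
  have hw : 1 / 4 ≤ s - t := by linarith [hs.1]
  have hw0 : 0 < s - t := by linarith
  rw [Function.comp_apply, truncPow_of_pos hw0]
  refine ENNReal.ofReal_le_ofReal ?_
  rcases le_total 0 a with ha | ha
  · exact (min_le_left _ _).trans (Real.rpow_le_rpow (by norm_num) hw ha)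
  · exact (min_le_right _ _).trans
      (Real.one_le_rpow_of_pos_of_le_one_of_nonpos hw0 (by linarith [hs.2]) ha)

lemma not_tentWave_ae_eq_truncPowConv {lam a : ℝ} (h0 : 0 < lam) (h1 : lam < 1) (ha : -1 < a)
    (ha' : a < 1) {μ : Measure ℝ} (hμ : ∀ᵐ t ∂μ, 0 ≤ t) :
    ¬ ∀ᵐ s ∂volume.restrict (Ici 0),
      truncPowConst a * ENNReal.ofReal (tentWave lam s) = truncPowConv a μ s := by
  intro hae
  have hK : ENNReal.ofReal (min ((1 / 4) ^ a) 1) * μ (Iic (1 / 2)) ≤ 0 := by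
    have hlim : Tendsto (fun ε : ℝ => truncPowConst a * ENNReal.ofReal ε) (𝓝[>] 0) (𝓝 0) := by
      have := ENNReal.Tendsto.const_mul (a := truncPowConst a)
        (ENNReal.tendsto_ofReal (tendsto_id (α := ℝ) (x := 𝓝 0)))
        (Or.inr (truncPowConst_ne_top ha ha'))
      simp only [ENNReal.ofReal_zero, mul_zero, id] at this
      exact this.mono_left nhdsWithin_le_nhds
    refine ge_of_tendsto hlim ?_
    filter_upwards [Ioo_mem_nhdsGT (by norm_num : (0 : ℝ) < 1 / 4)] with ε hε
    -- The equality holds only almost everywhere, so a good point is chosen within ε of 1, where the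
    -- tent wave is below ε.
    obtain ⟨s, hs, he⟩ := exists_mem_Ioo_of_ae_restrict_Ici hae
      (by linarith [hε.2] : 0 ≤ 1 - ε) (by linarith [hε.1] : 1 - ε < 1)
    refine (le_truncPowConv hμ ⟨by linarith [hε.2, hs.1], hs.2⟩).trans ?_
    rw [← he]
    gcongr
    exact (tentWave_le h1 ⟨by linarith [hε.2, hs.1], hs.2⟩).trans (by linarith [hs.1])
  have hμ0 : μ (Iic (1 / 2)) = 0 := by
    rcases mul_eq_zero.1 (nonpos_iff_eq_zero.1 hK) with h | h
    · rw [ENNReal.ofReal_eq_zero] at h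
      have : (0 : ℝ) < min ((1 / 4) ^ a) 1 := lt_min (by positivity) one_pos
      linarith
    · exact h
  obtain ⟨s, hs, he⟩ := exists_mem_Ioo_of_ae_restrict_Ici hae le_rfl
    (by norm_num : (0 : ℝ) < 1 / 2)
  have hz : truncPowConv a μ s = 0 := by
    rw [truncPowConv, ← lintegral_zero (μ := μ)]
    have : ∀ᵐ t ∂μ, ¬ t ≤ 1 / 2 := by
      rw [ae_iff]; simpa [Iic] using hμ0
    exact lintegral_congr_ae (this.mono fun t ht => truncPow_of_nonpos (by linarith [hs.2]))
  rw [hz] at he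
  have hpos := tentWave_pos h0 h1 (⟨hs.1, by linarith [hs.2]⟩ : s ∈ Ioo (0 : ℝ) 1)
  exact mul_ne_zero (truncPowConst_ne_zero a) (by simpa using hpos) he

/-! ### Excluding orders below two -/

/-- Tonelli needs s-finiteness, which an arbitrary μ lacks; here μ is a finite measure reweighted by
a density. -/
lemma sFinite_of_integrable_one_div_rpow {μ : Measure ℝ} (hμ : ∀ᵐ t ∂μ, 0 ≤ t) {τ : ℝ}
    (hint : Integrable (fun t : ℝ => 1 / (t + 1) ^ τ) μ) : SFinite μ := by
  have : IsFiniteMeasure (μ.withDensity fun t => ENNReal.ofReal (1 / (t + 1) ^ τ)) :=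
    isFiniteMeasure_withDensity_ofReal hint.2
  rw [← withDensity_inv_same (μ := μ) (f := fun t => ENNReal.ofReal (1 / (t + 1) ^ τ))
    (by fun_prop) (hμ.mono fun t ht => by simp; positivity) (ae_of_all _ fun t => ofReal_ne_top)]
  infer_instance

lemma not_lintegral_eq_log_gLambda {lam τ : ℝ} (h0 : 0 < lam) (h1 : lam < 1) (hτ0 : 0 < τ)
    (hτ2 : τ < 2) {μ : Measure ℝ} [SFinite μ] (hμ : ∀ᵐ t ∂μ, 0 ≤ t) :
    ¬ ∀ x : ℝ, 0 < x → ∫⁻ t, ENNReal.ofReal (1 / (t + x) ^ τ) ∂μ =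
      ENNReal.ofReal (Real.log (gLambda lam x)) := by
  intro hrep
  have ha : -1 < 1 - τ := by linarith
  have ha' : 1 - τ < 1 := by linarith
  have hpos : ∀ {f : ℝ → ℝ≥0∞}, ∀ᵐ t ∂(volume.restrict (Ici 0)).withDensity f, 0 ≤ t := fun {f} =>
    (withDensity_absolutelyContinuous _ f).ae_le (ae_restrict_mem measurableSet_Ici)
  have hmT := (measurable_tentWave lam).ennreal_ofReal
  have hmT' : Measurable fun t => truncPowConst (1 - τ) * ENNReal.ofReal (tentWave lam t) :=
    hmT.const_mul _
  have hmTK : ∀ x : ℝ, Measurable fun t : ℝ =>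
      ENNReal.ofReal (tentWave lam t) * ENNReal.ofReal (1 / (t + x) ^ 2) :=
    fun x => hmT.mul (by fun_prop)
  have hmF := measurable_truncPowConv (1 - τ) μ
  have hT : ∀ x : ℝ, 0 < x → ∫⁻ t, ENNReal.ofReal (1 / (t + x) ^ 2)
      ∂(volume.restrict (Ici 0)).withDensity
        (fun t => truncPowConst (1 - τ) * ENNReal.ofReal (tentWave lam t)) =
      truncPowConst (1 - τ) * ENNReal.ofReal (Real.log (gLambda lam x)) := by
    intro x hx
    rw [← lintegral_tentMeasure_sq h0 h1 hx, lintegral_withDensity_eq_lintegral_mul _ hmT'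
      (by fun_prop), lintegral_tentMeasure _ (by fun_prop),
      ← lintegral_const_mul _ (hmTK x)]
    exact lintegral_congr fun t => mul_assoc _ _ _
  have heq := ext_of_lintegral_one_div_add_sq (ν₁ := (volume.restrict (Ici 0)).withDensity
      (fun t => truncPowConst (1 - τ) * ENNReal.ofReal (tentWave lam t)))
    (ν₂ := (volume.restrict (Ici 0)).withDensity (truncPowConv (1 - τ) μ)) hpos hpos
    (fun x hx => by
      rw [hT x hx]
      exact ENNReal.mul_ne_top (truncPowConst_ne_top ha ha') ofReal_ne_top)
    (fun x hx => by
      rw [hT x hx, lintegral_withDensity_eq_lintegral_mul _ hmF (by fun_prop)]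
      have := lintegral_truncPowConv_mul (a := 1 - τ) hμ hx
      rw [_root_.sub_sub_cancel, hrep x hx] at this
      exact this.symm)
  rw [withDensity_eq_iff_of_sigmaFinite hmT'.aemeasurable hmF.aemeasurable] at heq
  exact not_tentWave_ae_eq_truncPowConv h0 h1 ha ha' hμ heq

/-- For τ ≤ 0 the kernel is nondecreasing in x, so log g(n+1) ≥ log g(1) > 0, against the decay. -/
lemma not_isGeneralizedStieltjes_of_nonpos {lam τ : ℝ} (h0 : 0 < lam) (h1 : lam < 1)
    (hτ : τ ≤ 0) : ¬ IsGeneralizedStieltjes τ (fun x : ℝ => Real.log (gLambda lam x)) := by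
  rintro ⟨μ, c, -, h⟩
  have hle : ∀ n : ℕ, Real.log (gLambda lam 1) ≤ Real.log (gLambda lam (n + 1)) := by
    intro n
    have hn : (0 : ℝ) < n + 1 := by positivity
    have e1 : Real.log (gLambda lam 1) = _ := (h 1 one_pos).2
    have e2 : Real.log (gLambda lam (n + 1)) = _ := (h (n + 1) hn).2
    rw [e1, e2]
    refine add_le_add (setIntegral_mono_on (h 1 one_pos).1 (h _ hn).1 measurableSet_Ici
      fun t ht => ?_) le_rfl
    have ht : (0 : ℝ) ≤ t := ht
    refine one_div_le_one_div_of_le (by positivity)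
      (Real.rpow_le_rpow_of_nonpos (by positivity) ?_ hτ)
    linarith [(Nat.cast_nonneg n : (0 : ℝ) ≤ n)]
  exact absurd (ge_of_tendsto' (tendsto_log_gLambda h0 h1) hle)
    (not_le.2 (log_gLambda_pos h0 h1 one_pos))

theorem proposition3p2 (lam : ℝ) (hlam0 : 0 < lam) (hlam1 : lam < 1) :
    IsGeneralizedStieltjes 2 (fun x : ℝ => Real.log (gLambda lam x)) ∧
      ∀ τ : ℝ, τ < 2 →
        ¬ IsGeneralizedStieltjes τ (fun x : ℝ => Real.log (gLambda lam x)) := by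
  refine ⟨isGeneralizedStieltjes_two_log_gLambda hlam0 hlam1, fun τ hτ2 => ?_⟩
  rcases le_or_gt τ 0 with hτ | hτ0
  · exact not_isGeneralizedStieltjes_of_nonpos hlam0 hlam1 hτ
  rintro ⟨μ, c, hc, h⟩
  have hμ : ∀ᵐ t ∂μ.restrict (Ici 0), 0 ≤ t := ae_restrict_mem measurableSet_Ici
  have hnn : ∀ {x : ℝ}, 0 < x → ∀ᵐ t ∂μ.restrict (Ici 0), 0 ≤ 1 / (t + x) ^ τ := fun hx =>
    hμ.mono fun t ht => by positivity
  -- The integral is nonnegative, so c ≤ log g(n+1), which tends to 0.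
  have hc0 : c = 0 := by
    refine le_antisymm (ge_of_tendsto' (tendsto_log_gLambda hlam0 hlam1) fun n => ?_) hc
    have hn : (0 : ℝ) < n + 1 := by positivity
    have e : Real.log (gLambda lam (n + 1)) = _ := (h (n + 1) hn).2
    rw [e]
    exact le_add_of_nonneg_left (integral_nonneg_of_ae (hnn hn))
  have := sFinite_of_integrable_one_div_rpow hμ (h 1 one_pos).1
  refine not_lintegral_eq_log_gLambda hlam0 hlam1 hτ0 hτ2 hμ fun x hx => ?_
  have e : Real.log (gLambda lam x) = _ := (h x hx).2
  rw [e, hc0, add_zero, ofReal_integral_eq_lintegral_ofReal (h x hx).1 (hnn hx)]
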